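/- Let $d\ge 1$, $\alpha\in(0,2)$, and let $(\Omega,\mathcal F,\mathbb P)$ be a probability space with a group of transformations $\{\tau_x\}_{x\in\mathbb R^d}$ of $\Omega$ ($\tau_0=\mathrm{id}$, $\tau_x\circ\tau_y=\tau_{x+y}$) such that $(x,\omega)\mapsto\tau_x\omega$ is measurable, $\mathbb P(\tau_xA)=\mathbb P(A)$ for all $A\in\mathcal F$ and $x\in\mathbb R^d$, and $\mathbb P(A)\in\{0,1\}$ whenever $A\in\mathcal F$ and $\tau_xA=A$ for all $x$. Let $\mu:\Omega\to[0,\infty)$ be a random variable with $\mathbb E[\mu]=1$ such that for every $\omega$, $\mu(\tau_x\omega)>0$ for a.e. $x\in\mathbb R^d$. Let $\kappa:\mathbb R^d\times\mathbb R^d\times\Omega\to[0,\infty)$ be measurable with $$\kappa(x,y;\omega)=\kappa(y,x;\omega),\qquad \kappa(x+z,y+z;\omega)=\kappa(x,y;\tau_z\omega)\qquad\text{for all } x,y,z\in\mathbb R^d,\ \omega\in\Omega,$$ and such that for $\mathbb P$-a.e. $\omega$ the function $x\mapsto\int_{\mathbb R^d}(1\wedge|z|^2)\,\kappa(x,x+z;\omega)\,|z|^{-d-\alpha}\,dz$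 belongs to $L^1_{loc}(\mathbb R^d;dx)$. Let $\Gamma\subset\mathbb R^d$ be a non-empty open set with $rx\in\Gamma$ for all $x\in\Gamma$ and $r\in\mathbb R\setminus\{0\}$. For $\varepsilon>0$ and $\omega\in\Omega$ put $\mu^{\varepsilon,\omega}(dx)=\mu(\tau_{x/\varepsilon}\omega)\,dx$, $$\mathcal E^{\varepsilon,\omega}(f,f)=\frac12\iint_{\{x\ne y\}}(f(x)-f(y))^2\,\frac{\kappa(x/\varepsilon,y/\varepsilon;\omega)}{|x-y|^{d+\alpha}}\,\mathbf 1_{\{x-y\in\Gamma\}}\,dx\,dy,$$ and let $\mathcal F^{\varepsilon,\omega}$ be the closure of $C_c^1(\mathbb R^d)$ with respect to the norm $\big(\mathcal E^{\varepsilon,\omega}(f,f)+\|f\|^2_{L^2(\mathbb R^d;\mu^{\varepsilon,\omega})}\big)^{1/2}$. Suppose that there are non-negative random variables $\Lambda_1\le\Lambda_2$ on $\Omega$ with $\mathbb E[\Lambda_1^{-1}]<\infty$ such that one of the following holds: * (A2') for a.s. $\omega$, $\ \Lambda_1(\tau_x\omega)+\Lambda_1(\tau_y\omega)\le\kappa(x,y;\omega)\le\Lambda_2(\tau_x\omega)+\Lambda_2(\tau_y\omega)$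 for every $x,y\in\mathbb R^d$; * (B2') for a.s. $\omega$, $\ \Lambda_1(\tau_x\omega)\Lambda_1(\tau_y\omega)\le\kappa(x,y;\omega)\le\Lambda_2(\tau_x\omega)\Lambda_2(\tau_y\omega)$ for every $x,y\in\mathbb R^d$. Then there is a set $\Omega_0\subset\Omega$ of full probability such that for every $\omega\in\Omega_0$ and every collection $\{f_\varepsilon:\varepsilon\in(0,1]\}$ with $f_\varepsilon\in\mathcal F^{\varepsilon,\omega}$ for all $\varepsilon\in(0,1]$ and $$\limsup_{\varepsilon\to0}\big(\|f_\varepsilon\|_\infty+\mathcal E^{\varepsilon,\omega}(f_\varepsilon,f_\varepsilon)\big)<\infty,$$ the collection $\{f_\varepsilon\}$ is pre-compact as $\varepsilon\to0$ in $L^1(B(0,r);dx)$ for all $r>1$; that is, for every sequence $\{\varepsilon_n\}\subset(0,1]$ with $\varepsilon_n\to0$ there are a subsequence $\{\varepsilon_{n_k}\}$ and a function $f\in L^1_{loc}(\mathbb R^d;dx)$ such that $f_{\varepsilon_{n_k}}\to f$ in $L^1(B(0,r);dx)$ for every $r>1$. -/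

import Mathlib

open MeasureTheory Filter Topology Set
open scoped ENNReal

/-- The space `ℝ^d` with its Euclidean norm. -/
abbrev Rd (d : ℕ) : Type := EuclideanSpace ℝ (Fin d)

/-- A stationary and ergodic measurable group of transformations `(τ_x)_{x ∈ ℝ^d}` of the
probability space `(Ω, P)`. -/
structure IsStationaryErgodic {d : ℕ} {Ω : Type*} [MeasurableSpace Ω] (P : Measure Ω)
    (τ : Rd d → Ω → Ω) : Prop where
  zero : ∀ ω, τ 0 ω = ω
  add : ∀ x y ω, τ x (τ y ω) = τ (x + y) ω
  measurable : Measurable (fun p : Rd d × Ω => τ p.1 p.2)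
  stationary : ∀ (x : Rd d) (A : Set Ω), MeasurableSet A → P (τ x '' A) = P A
  ergodic : ∀ A : Set Ω, MeasurableSet A → (∀ x : Rd d, τ x '' A = A) → P A = 0 ∨ P A = 1

/-- The random density `μ` of the reference measures: a non-negative random variable of mean one
such that, for every `ω`, `μ (τ_x ω) > 0` for almost every `x`. -/
structure IsReferenceDensity {d : ℕ} {Ω : Type*} [MeasurableSpace Ω] (P : Measure Ω)
    (τ : Rd d → Ω → Ω) (μ : Ω → ℝ) : Prop where
  measurable : Measurable μ
  nonneg : ∀ ω, 0 ≤ μ ω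
  pos : ∀ ω, ∀ᵐ x : Rd d, 0 < μ (τ x ω)
  mean_one : ∫⁻ ω, ENNReal.ofReal (μ ω) ∂P = 1

/-- The random coefficient `κ (x, y; ω)`: non-negative, jointly measurable, symmetric in `(x, y)`,
shift covariant, and such that almost surely
`x ↦ ∫ (1 ∧ |z|²) κ (x, x + z; ω) |z|^{-(d+α)} dz` is locally integrable. -/
structure IsRandomCoefficient {d : ℕ} {Ω : Type*} [MeasurableSpace Ω] (P : Measure Ω)
    (τ : Rd d → Ω → Ω) (α : ℝ) (κ : Rd d → Rd d → Ω → ℝ) : Prop where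
  measurable : Measurable (fun p : Rd d × Rd d × Ω => κ p.1 p.2.1 p.2.2)
  nonneg : ∀ x y ω, 0 ≤ κ x y ω
  symm : ∀ x y ω, κ x y ω = κ y x ω
  shift : ∀ x y z ω, κ (x + z) (y + z) ω = κ x y (τ z ω)
  domain : ∀ᵐ ω ∂P, ∀ K : Set (Rd d), IsCompact K →
    ∫⁻ x in K, ∫⁻ z : Rd d,
      ENNReal.ofReal (min 1 (‖z‖ ^ 2) * (κ x (x + z) ω / ‖z‖ ^ ((d : ℝ) + α))) < ∞

/-- A symmetric infinite open cone: a non-empty open set that is stable under multiplication by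
every non-zero real number. -/
structure IsSymmetricCone {d : ℕ} (Γ : Set (Rd d)) : Prop where
  nonempty : Γ.Nonempty
  isOpen : IsOpen Γ
  smul_mem : ∀ x ∈ Γ, ∀ r : ℝ, r ≠ 0 → r • x ∈ Γ

/-- Lower and upper bounds of summation form on `κ`, with `E[Λ₁⁻¹] < ∞` (where `1/0 = ∞`). -/
def SumBounds {d : ℕ} {Ω : Type*} [MeasurableSpace Ω] (P : Measure Ω)
    (τ : Rd d → Ω → Ω) (κ : Rd d → Rd d → Ω → ℝ) : Prop :=
  ∃ Λ₁ Λ₂ : Ω → ℝ, Measurable Λ₁ ∧ Measurable Λ₂ ∧ (∀ ω, 0 ≤ Λ₁ ω ∧ Λ₁ ω ≤ Λ₂ ω) ∧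
    (∀ᵐ ω ∂P, ∀ x y : Rd d,
      Λ₁ (τ x ω) + Λ₁ (τ y ω) ≤ κ x y ω ∧ κ x y ω ≤ Λ₂ (τ x ω) + Λ₂ (τ y ω)) ∧
    ∫⁻ ω, (ENNReal.ofReal (Λ₁ ω))⁻¹ ∂P < ∞

/-- Lower and upper bounds of product form on `κ`, with `E[Λ₁⁻¹] < ∞` (where `1/0 = ∞`). -/
def ProductBounds {d : ℕ} {Ω : Type*} [MeasurableSpace Ω] (P : Measure Ω)
    (τ : Rd d → Ω → Ω) (κ : Rd d → Rd d → Ω → ℝ) : Prop :=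
  ∃ Λ₁ Λ₂ : Ω → ℝ, Measurable Λ₁ ∧ Measurable Λ₂ ∧ (∀ ω, 0 ≤ Λ₁ ω ∧ Λ₁ ω ≤ Λ₂ ω) ∧
    (∀ᵐ ω ∂P, ∀ x y : Rd d,
      Λ₁ (τ x ω) * Λ₁ (τ y ω) ≤ κ x y ω ∧ κ x y ω ≤ Λ₂ (τ x ω) * Λ₂ (τ y ω)) ∧
    ∫⁻ ω, (ENNReal.ofReal (Λ₁ ω))⁻¹ ∂P < ∞

/-- The measure `μ (τ_{x/ε} ω) dx`. -/
noncomputable def scaledMeasure {d : ℕ} {Ω : Type*} (τ : Rd d → Ω → Ω) (μ : Ω → ℝ)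
    (ε : ℝ) (ω : Ω) : Measure (Rd d) :=
  volume.withDensity (fun x => ENNReal.ofReal (μ (τ (ε⁻¹ • x) ω)))

/-- The scaled energy `𝓔^{ε,ω}(f, f)`, with values in `[0, ∞]`:
`1/2 ∬ (f x - f y)² κ (x/ε, y/ε; ω) |x - y|^{-(d+α)} dx dy`
over the pairs off the diagonal with `x - y ∈ Γ`. -/
noncomputable def scaledEnergy {d : ℕ} {Ω : Type*} (κ : Rd d → Rd d → Ω → ℝ) (Γ : Set (Rd d))
    (α ε : ℝ) (ω : Ω) (f : Rd d → ℝ) : ℝ≥0∞ :=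
  2⁻¹ * ∫⁻ p in {p : Rd d × Rd d | p.1 ≠ p.2 ∧ p.1 - p.2 ∈ Γ},
    ENNReal.ofReal ((f p.1 - f p.2) ^ 2 *
      (κ (ε⁻¹ • p.1) (ε⁻¹ • p.2) ω / ‖p.1 - p.2‖ ^ ((d : ℝ) + α)))

/-- The domain `𝓕^{ε,ω}`: the functions of `L²(μ^{ε,ω})` with finite energy that belong to the
closure of `C_c^1(ℝ^d)` for the norm `(𝓔^{ε,ω}(f, f) + ‖f‖²_{L²(μ^{ε,ω})})^{1/2}`. -/
def scaledDomain {d : ℕ} {Ω : Type*} (τ : Rd d → Ω → Ω) (μ : Ω → ℝ)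
    (κ : Rd d → Rd d → Ω → ℝ) (Γ : Set (Rd d)) (α ε : ℝ) (ω : Ω) : Set (Rd d → ℝ) :=
  {f | MemLp f 2 (scaledMeasure τ μ ε ω) ∧ scaledEnergy κ Γ α ε ω f < ∞ ∧
    ∀ δ : ℝ≥0∞, 0 < δ → ∃ g : Rd d → ℝ, ContDiff ℝ 1 g ∧ HasCompactSupport g ∧
      scaledEnergy κ Γ α ε ω (f - g) +
        eLpNorm (f - g) 2 (scaledMeasure τ μ ε ω) ^ 2 < δ}

/-- Pre-compactness of `{f_ε : ε ∈ (0,1]}` as `ε → 0` in `L¹(B(0,r))` for every `r > 1`: along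
every sequence `ε_n → 0` in `(0,1]` some subsequence converges, in `L¹(B(0,r))` for every `r > 1`,
to a function of `L¹_loc`. -/
def PrecompactAtZero {d : ℕ} (f : ℝ → Rd d → ℝ) : Prop :=
  ∀ e : ℕ → ℝ, (∀ n, e n ∈ Ioc (0 : ℝ) 1) → Tendsto e atTop (𝓝 0) →
    ∃ (φ : ℕ → ℕ) (g : Rd d → ℝ), StrictMono φ ∧ LocallyIntegrable g volume ∧
      ∀ r : ℝ, 1 < r →
        Tendsto (fun k => eLpNorm (f (e (φ k)) - g) 1 (volume.restrict (Metric.ball 0 r)))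
          atTop (𝓝 0)

/-! A bounded family is weak-* sequentially compact in `L^∞`, so along a subsequence its averages
over `x - δS` converge for every `x` and `δ > 0`. This becomes convergence in `L¹` of balls as soon
as the functions are `L¹`-close to such averages, uniformly along the tail
(`exists_subseq_tendsto_of_translation_estimate`).

The closeness comes from the energy (`exists_translation_estimate`). Take for `S` a small ball
inside the cone, so that every increment `δw` lies in `Γ`. Where the field `Λ` (the lower bound
`Λ₁`) is at least `s ≤ 1` at both rescaled points, `κ ≥ s²`; with `t ≤ θ + t²/θ` the increments
there cost `θ` plus a multiple of `θ⁻¹ s⁻² δ^α` times the energy. The remaining points cost the sup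
bound times their measure. Choose `s`, then `θ`, then `δ`.

It remains to see that `{x ∈ B(0,m) : Λ(τ_{x/ε} ω) < s}` has small measure uniformly in `ε ∈ (0,1]`.
After scaling this is a proportion of bad points in a ball of radius about `m/ε`. Vitali's covering,
transferred to `Ω` by stationarity, gives a maximal inequality: the probability that this proportion
exceeds `c` in some ball of positive integer radius is at most `10^d P(Λ < s)/c`. This tends to `0`
with `s`, since `E[Λ⁻¹] < ∞` forces `Λ > 0` almost surely. -/

/-! ### Weak-* compactness and a compactness criterion in `L¹` of balls -/

/-- A uniformly bounded sequence of functions has a subsequence whose integrals against every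
integrable function converge. -/
theorem exists_subseq_tendsto_integral_mul {X : Type*} [MeasurableSpace X] {ν : Measure X}
    [IsSeparable ν] {u : ℕ → X → ℝ} {C : ℝ} (hu : ∀ n, Measurable (u n))
    (hC : ∀ n x, |u n x| ≤ C) :
    ∃ ψ : ℕ → ℕ, StrictMono ψ ∧ ∀ p : X → ℝ, Integrable p ν →
      ∃ L : ℝ, Tendsto (fun k => ∫ x, u (ψ k) x * p x ∂ν) atTop (𝓝 L) := by
  have hint : ∀ n (p : X → ℝ), Integrable p ν → Integrable (fun x => u n x * p x) ν :=
    fun n p hp => hp.bdd_mul (hu n).aestronglyMeasurable (Eventually.of_forall (hC n))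
  -- Needed for the separability of `L¹(ν)`, which makes closed balls of its dual weak-*
  -- sequentially compact.
  have : Fact ((1 : ℝ≥0∞) ≠ ∞) := ⟨ENNReal.one_ne_top⟩
  let T : ℕ → StrongDual ℝ (Lp ℝ 1 ν) := fun n => LinearMap.mkContinuous
    { toFun := fun p => ∫ x, u n x * p x ∂ν
      map_add' := fun p q => by
        rw [← integral_add (hint n _ (L1.integrable_coeFn p)) (hint n _ (L1.integrable_coeFn q))]
        refine integral_congr_ae ?_
        filter_upwards [Lp.coeFn_add p q] with x hx
        rw [hx, Pi.add_apply, mul_add]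
      map_smul' := fun c p => by
        rw [RingHom.id_apply, smul_eq_mul, ← integral_const_mul]
        refine integral_congr_ae ?_
        filter_upwards [Lp.coeFn_smul c p] with x hx
        rw [hx, Pi.smul_apply, smul_eq_mul]; ring } C
    (fun p => by
      rw [L1.norm_eq_integral_norm, ← integral_const_mul]
      refine norm_integral_le_of_norm_le ((L1.integrable_coeFn p).norm.const_mul C)
        (Eventually.of_forall fun x => ?_)
      rw [norm_mul]
      exact mul_le_mul_of_nonneg_right (hC n x) (norm_nonneg _))
  have hT : ∀ n, StrongDual.toWeakDual (T n) ∈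
      WeakDual.toStrongDual ⁻¹' Metric.closedBall (0 : StrongDual ℝ (Lp ℝ 1 ν)) (max C 0) := by
    intro n
    simp only [mem_preimage, StrongDual.toStrongDual_toWeakDual, mem_closedBall_zero_iff]
    exact LinearMap.mkContinuous_norm_le' _ _
  obtain ⟨L, -, ψ, hψ, hL⟩ := WeakDual.isSeqCompact_closedBall ℝ (Lp ℝ 1 ν) _ _ hT
  refine ⟨ψ, hψ, fun p hp => ⟨L (hp.toL1 p), ?_⟩⟩
  have := ((WeakDual.eval_continuous (𝕜 := ℝ) (hp.toL1 p)).tendsto L).comp hL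
  refine this.congr fun k => ?_
  change ∫ x, u (ψ k) x * (hp.toL1 p) x ∂ν = _
  refine integral_congr_ae ?_
  filter_upwards [hp.coeFn_toL1] with x hx
  rw [hx]

/-- The average of `u` over `x - δ S` as an integral of `u` against an integrable kernel. -/
theorem setIntegral_comp_sub_smul {d : ℕ} {S : Set (Rd d)} (hS : MeasurableSet S)
    {δ : ℝ} (hδ : 0 < δ) (u : Rd d → ℝ) (x : Rd d) :
    ∫ w in S, u (x - δ • w) =
      ∫ y, u y * ((δ ^ d)⁻¹ * S.indicator 1 (δ⁻¹ • (x - y))) := by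
  have h1 : ∫ w in S, u (x - δ • w) =
      ∫ w, (fun z => S.indicator 1 (δ⁻¹ • z) * u (x - z)) (δ • w) := by
    rw [← integral_indicator hS]
    refine integral_congr_ae (Eventually.of_forall fun w => ?_)
    simp only [smul_smul, inv_mul_cancel₀ hδ.ne', one_smul]
    by_cases hw : w ∈ S <;> simp [hw]
  rw [h1, Measure.integral_comp_smul volume (fun z => S.indicator 1 (δ⁻¹ • z) * u (x - z)) δ,
    ← integral_sub_left_eq_self _ volume x, smul_eq_mul, ← integral_const_mul,
    finrank_euclideanSpace_fin, abs_of_pos (by positivity)]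
  refine integral_congr_ae (Eventually.of_forall fun y => ?_)
  simp only [sub_sub_cancel]
  ring

theorem integrable_indicator_smul_sub {d : ℕ} {S : Set (Rd d)} (hS : MeasurableSet S)
    (hfin : volume S ≠ ∞) {δ : ℝ} (hδ : 0 < δ) (x : Rd d) :
    Integrable (fun y => (δ ^ d)⁻¹ * S.indicator 1 (δ⁻¹ • (x - y)) : Rd d → ℝ) := by
  have h : Integrable (S.indicator (1 : Rd d → ℝ)) := (integrable_indicator_iff hS).2
    (integrableOn_const hfin)
  exact ((h.comp_smul (inv_ne_zero hδ.ne')).comp_sub_left x).const_mul _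

/-- Limits in `L¹` of balls of increasing radius can be glued together. -/
theorem exists_locallyIntegrable_of_tendsto_ball {d : ℕ} {u : ℕ → Rd d → ℝ} {g : ℕ → Rd d → ℝ}
    (hu : ∀ n, Measurable (u n))
    (hg : ∀ m, MemLp (g m) 1 (volume.restrict (Metric.ball 0 m)))
    (h : ∀ m : ℕ, Tendsto (fun k => eLpNorm (u k - g m) 1 (volume.restrict (Metric.ball 0 m)))
      atTop (𝓝 0)) :
    ∃ G : Rd d → ℝ, LocallyIntegrable G volume ∧ ∀ r : ℝ,
      Tendsto (fun k => eLpNorm (u k - G) 1 (volume.restrict (Metric.ball 0 r)))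
        atTop (𝓝 0) := by
  have hmono : ∀ {i j : ℕ}, i ≤ j →
      volume.restrict (Metric.ball (0 : Rd d) i) ≤ volume.restrict (Metric.ball 0 j) :=
    fun hij => Measure.restrict_mono (Metric.ball_subset_ball (by exact_mod_cast hij)) le_rfl
  have hcompat : ∀ i j : ℕ, i ≤ j → g i =ᵐ[volume.restrict (Metric.ball 0 i)] g j := by
    intro i j hij
    have hgj := (hg j).mono_measure (hmono hij)
    have h0 : eLpNorm (g i - g j) 1 (volume.restrict (Metric.ball 0 i)) = 0 := by
      have hlim := (h i).add (tendsto_of_tendsto_of_tendsto_of_le_of_le tendsto_const_nhds (h j)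
        (fun _ => zero_le) fun k => eLpNorm_mono_measure (u k - g j) (hmono hij))
      rw [add_zero] at hlim
      refine le_antisymm (ge_of_tendsto' hlim fun k => ?_) zero_le
      have : g i - g j = (u k - g j) - (u k - g i) := by ext; simp
      rw [this, add_comm]
      refine (eLpNorm_sub_le ((hu k).aestronglyMeasurable.sub hgj.1)
        ((hu k).aestronglyMeasurable.sub (hg i).1) le_rfl).trans_eq ?_
      rw [add_comm]
    rw [eLpNorm_eq_zero_iff ((hg i).1.sub hgj.1) one_ne_zero] at h0
    filter_upwards [h0] with x hx using sub_eq_zero.1 hx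
  -- The index is the least integer `i` with `x` in the open ball of radius `i`, so `i ≤ m` whenever
  -- `‖x‖ < m`.
  let G : Rd d → ℝ := fun x => g (⌊‖x‖⌋₊ + 1) x
  have hG : ∀ m : ℕ, G =ᵐ[volume.restrict (Metric.ball 0 m)] g m := by
    intro m
    have : ∀ᵐ x ∂(volume : Measure (Rd d)), ∀ i ≤ m, x ∈ Metric.ball (0 : Rd d) i →
        g i x = g m x := by
      rw [ae_all_iff]; intro i
      by_cases hi : i ≤ m
      · filter_upwards [(ae_restrict_iff' Metric.isOpen_ball.measurableSet).1 (hcompat i m hi)]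
          with x hx _ using hx
      · exact Eventually.of_forall fun x h => absurd h hi
    rw [EventuallyEq, ae_restrict_iff' Metric.isOpen_ball.measurableSet]
    filter_upwards [this] with x hx hxm
    rw [mem_ball_zero_iff] at hxm
    refine hx _ ((Nat.floor_lt (norm_nonneg _)).2 hxm) ?_
    rw [mem_ball_zero_iff]; push_cast
    exact Nat.lt_floor_add_one _
  refine ⟨G, ?_, fun r => ?_⟩
  · rw [locallyIntegrable_iff]
    intro K hK
    obtain ⟨r, hr⟩ := hK.isBounded.subset_ball 0
    obtain ⟨m, hm⟩ := exists_nat_ge r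
    have h1 : IntegrableOn G (Metric.ball 0 m) :=
      (memLp_one_iff_integrable.1 (hg m)).congr (hG m).symm
    exact h1.mono_set (hr.trans (Metric.ball_subset_ball hm))
  · obtain ⟨m, hm⟩ := exists_nat_ge r
    refine tendsto_of_tendsto_of_tendsto_of_le_of_le tendsto_const_nhds (h m)
      (fun _ => zero_le) fun k => ?_
    refine (eLpNorm_mono_measure _
      (Measure.restrict_mono (Metric.ball_subset_ball hm) le_rfl)).trans_eq
      (eLpNorm_congr_ae ?_)
    filter_upwards [hG m] with x hx
    simp [hx]

theorem enorm_measureReal_mul_sub_setIntegral_le {d : ℕ} {S : Set (Rd d)}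
    (hfin : volume S ≠ ∞) {u : Rd d → ℝ} {C : ℝ} (hu : Measurable u) (hC : ∀ x, |u x| ≤ C)
    (δ : ℝ) (x : Rd d) :
    ‖volume.real S * u x - ∫ w in S, u (x - δ • w)‖ₑ ≤
      ∫⁻ w in S, ‖u x - u (x - δ • w)‖ₑ := by
  have hint : IntegrableOn (fun w => u (x - δ • w)) S := by
    refine Measure.integrableOn_of_bounded (M := C) hfin
      (hu.comp (by fun_prop : Measurable fun w : Rd d => x - δ • w)).aestronglyMeasurable ?_
    exact Eventually.of_forall fun w => hC _
  have : volume.real S * u x - ∫ w in S, u (x - δ • w) = ∫ w in S, (u x - u (x - δ • w)) := by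
    have hc : IntegrableOn (fun _ : Rd d => u x) S := integrableOn_const hfin
    rw [integral_sub hc hint, setIntegral_const, smul_eq_mul]
  rw [this]
  exact enorm_integral_le_lintegral_enorm _

/-- A uniformly bounded sequence whose averages over small translates are close to the sequence,
uniformly along its tail, has a subsequence that converges in `L¹` of every ball. -/
theorem exists_subseq_tendsto_of_translation_estimate {d : ℕ} {S : Set (Rd d)}
    (hS : MeasurableSet S) (hfin : volume S ≠ ∞) (hpos : volume S ≠ 0)
    {u : ℕ → Rd d → ℝ} {C : ℝ} (hu : ∀ n, Measurable (u n)) (hC : ∀ n x, |u n x| ≤ C)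
    (h : ∀ m : ℕ, ∀ η : ℝ≥0∞, 0 < η → ∃ δ : ℝ, 0 < δ ∧ ∃ n₀ : ℕ, ∀ n ≥ n₀,
      ∫⁻ x in Metric.ball (0 : Rd d) m, ∫⁻ w in S, ‖u n x - u n (x - δ • w)‖ₑ ≤ η) :
    ∃ (ψ : ℕ → ℕ) (G : Rd d → ℝ), StrictMono ψ ∧ LocallyIntegrable G volume ∧ ∀ r : ℝ,
      Tendsto (fun k => eLpNorm (u (ψ k) - G) 1 (volume.restrict (Metric.ball 0 r)))
        atTop (𝓝 0) := by
  obtain ⟨ψ, hψ, hlim⟩ := exists_subseq_tendsto_integral_mul (ν := (volume : Measure (Rd d))) hu hC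
  have hbfin : ∀ m : ℕ, volume (Metric.ball (0 : Rd d) m) ≠ ∞ := fun m => measure_ball_lt_top.ne
  have hLp : ∀ n (m : ℕ), MemLp (u n) 1 (volume.restrict (Metric.ball (0 : Rd d) m)) := by
    intro n m
    have : IsFiniteMeasure (volume.restrict (Metric.ball (0 : Rd d) m)) :=
      isFiniteMeasure_restrict.2 (hbfin m)
    exact MemLp.of_bound (hu n).aestronglyMeasurable C (Eventually.of_forall fun x => hC n x)
  have hcauchy : ∀ m : ℕ, ∀ η : ℝ≥0∞, 0 < η → ∃ N, ∀ k ≥ N, ∀ l ≥ N,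
      eLpNorm (u (ψ k) - u (ψ l)) 1 (volume.restrict (Metric.ball 0 m)) ≤ η := by
    intro m η hη
    have : IsFiniteMeasure (volume.restrict (Metric.ball (0 : Rd d) m)) :=
      isFiniteMeasure_restrict.2 (hbfin m)
    -- Each of the two functions is compared with its averages, and these with their limit: four
    -- errors `η₁`, after multiplication by `volume S`.
    set η₁ : ℝ≥0∞ := volume S * η / 4 with hη₁
    have hη₁pos : 0 < η₁ := ENNReal.div_pos (mul_ne_zero hpos hη.ne') (by norm_num)
    obtain ⟨δ, hδ, n₀, hn₀⟩ := h m η₁ hη₁pos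
    -- The averages are pairings with a fixed integrable kernel, so weak-* convergence makes them
    -- converge at every `x`; dominated convergence upgrades this to `L¹` of the ball.
    let A : ℕ → Rd d → ℝ := fun k x => ∫ w in S, u (ψ k) (x - δ • w)
    have hA : ∀ k, StronglyMeasurable (A k) := fun k => by
      refine StronglyMeasurable.integral_prod_right (f := fun x w => u (ψ k) (x - δ • w)) ?_
      exact ((hu (ψ k)).comp (by fun_prop)).stronglyMeasurable
    have hAb : ∀ k x, ‖A k x‖ ≤ C * volume.real S := fun k x =>
      norm_setIntegral_le_of_norm_le_const hfin.lt_top fun w _ => hC _ _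
    have hAlim : ∀ x, ∃ l, Tendsto (fun k => A k x) atTop (𝓝 l) := fun x => by
      simp only [A, setIntegral_comp_sub_smul hS hδ]
      exact hlim _ (integrable_indicator_smul_sub hS hfin hδ x)
    choose L hL using hAlim
    have hLm : StronglyMeasurable L :=
      stronglyMeasurable_of_tendsto atTop hA (tendsto_pi_nhds.2 hL)
    have hAL : Tendsto (fun k => ∫⁻ x in Metric.ball (0 : Rd d) m, ‖A k x - L x‖ₑ)
        atTop (𝓝 0) := by
      have := tendsto_lintegral_norm_of_dominated_convergence
        (μ := volume.restrict (Metric.ball (0 : Rd d) m)) (F := A) (f := L)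
        (fun k => (hA k).aestronglyMeasurable) (bound := fun _ => C * volume.real S)
        (integrable_const _).2 (fun k => Eventually.of_forall (hAb k))
        (Eventually.of_forall hL)
      simpa only [ofReal_norm] using this
    obtain ⟨N₁, hN₁⟩ := eventually_atTop.1 ((ENNReal.tendsto_nhds_zero.1 hAL) η₁ hη₁pos)
    have hV : ‖volume.real S‖ₑ = volume S := by
      rw [Real.enorm_of_nonneg measureReal_nonneg, ofReal_measureReal hfin]
    have hone : ∀ k ≥ max N₁ n₀,
        ∫⁻ x in Metric.ball (0 : Rd d) m, ‖volume.real S * u (ψ k) x - L x‖ₑ ≤ η₁ + η₁ := by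
      intro k hk
      calc ∫⁻ x in Metric.ball (0 : Rd d) m, ‖volume.real S * u (ψ k) x - L x‖ₑ
          ≤ ∫⁻ x in Metric.ball (0 : Rd d) m,
              (∫⁻ w in S, ‖u (ψ k) x - u (ψ k) (x - δ • w)‖ₑ) + ‖A k x - L x‖ₑ := by
            refine lintegral_mono fun x => ?_
            have : volume.real S * u (ψ k) x - L x =
              (volume.real S * u (ψ k) x - A k x) + (A k x - L x) := by ring
            rw [this]
            refine (enorm_add_le _ _).trans (add_le_add_left ?_ _)
            exact enorm_measureReal_mul_sub_setIntegral_le hfin (hu _) (hC _) δ x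
        _ = _ := lintegral_add_right _ ((hA k).measurable.sub hLm.measurable).enorm
        _ ≤ η₁ + η₁ := add_le_add
            (hn₀ _ ((le_max_right _ _).trans (hk.trans (hψ.id_le k))))
            (hN₁ k ((le_max_left _ _).trans hk))
    refine ⟨max N₁ n₀, fun k hk l hl => ?_⟩
    have hsum : volume S * eLpNorm (u (ψ k) - u (ψ l)) 1 (volume.restrict (Metric.ball 0 m)) ≤
        volume S * η := by
      rw [eLpNorm_one_eq_lintegral_enorm, ← hV,
        ← lintegral_const_mul _ ((hu (ψ k)).sub (hu (ψ l))).enorm]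
      calc ∫⁻ x in Metric.ball (0 : Rd d) m, ‖volume.real S‖ₑ * ‖(u (ψ k) - u (ψ l)) x‖ₑ
          ≤ ∫⁻ x in Metric.ball (0 : Rd d) m, ‖volume.real S * u (ψ k) x - L x‖ₑ +
              ‖volume.real S * u (ψ l) x - L x‖ₑ := by
            refine lintegral_mono fun x => ?_
            rw [← enorm_mul]
            have : volume.real S * (u (ψ k) - u (ψ l)) x =
              (volume.real S * u (ψ k) x - L x) - (volume.real S * u (ψ l) x - L x) := by
              rw [Pi.sub_apply]; ring
            rw [this]
            exact enorm_sub_le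
        _ = _ := lintegral_add_right _ (((hu (ψ l)).const_mul _).sub hLm.measurable).enorm
        _ ≤ (η₁ + η₁) + (η₁ + η₁) := add_le_add (hone k hk) (hone l hl)
        _ = ‖volume.real S‖ₑ * η := by
            rw [hV, ← two_mul, ← two_mul, ← mul_assoc, hη₁]
            norm_num
            exact ENNReal.mul_div_cancel (by norm_num) (by norm_num)
    exact (ENNReal.mul_le_mul_iff_right hpos hfin).1 hsum
  have hlimit : ∀ m : ℕ, ∃ g : Rd d → ℝ, MemLp g 1 (volume.restrict (Metric.ball 0 m)) ∧
      Tendsto (fun k => eLpNorm (u (ψ k) - g) 1 (volume.restrict (Metric.ball 0 m)))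
        atTop (𝓝 0) := by
    intro m
    have hc : CauchySeq fun k => (hLp (ψ k) m).toLp (u (ψ k)) := by
      refine EMetric.cauchySeq_iff_NNReal.2 fun ε hε => ?_
      obtain ⟨N, hN⟩ := hcauchy m ((ε / 2 : NNReal) : ℝ≥0∞)
        (by exact_mod_cast half_pos hε)
      refine ⟨N, fun n hn => ?_⟩
      rw [Lp.edist_toLp_toLp]
      exact (hN n hn N le_rfl).trans_lt (by exact_mod_cast half_lt_self hε)
    obtain ⟨g, hg⟩ := cauchySeq_tendsto_of_complete hc
    refine ⟨g, Lp.memLp g, ?_⟩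
    rw [← Lp.toLp_coeFn g (Lp.memLp g)] at hg
    exact (Lp.tendsto_Lp_iff_tendsto_eLpNorm'' _ (fun k => hLp (ψ k) m) _ _).1 hg
  choose g hg hglim using hlimit
  obtain ⟨G, hG, hGlim⟩ := exists_locallyIntegrable_of_tendsto_ball (fun k => hu (ψ k)) hg hglim
  exact ⟨ψ, G, hψ, hG, hGlim⟩

/-! ### Maximal inequality along the flow and uniform smallness of the bad sets -/

/-- Vitali's covering argument: a set each point of which is the center of a ball on which `F` has
average larger than `c` has measure at most `5 ^ d / c` times the integral of `F`. -/
theorem mul_measure_le_of_forall_closedBall {d : ℕ} {F : Rd d → ℝ≥0∞} {c : ℝ≥0∞} {R K : ℝ}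
    {A : Set (Rd d)} (hA : A ⊆ Metric.closedBall 0 R)
    (h : ∀ x ∈ A, ∃ r : ℝ, 0 < r ∧ r ≤ K ∧
      c * volume (Metric.closedBall x r) ≤ ∫⁻ y in Metric.closedBall x r, F y) :
    c * volume A ≤ 5 ^ d * ∫⁻ y in Metric.closedBall (0 : Rd d) (R + K), F y := by
  choose! r hr0 hrK hr using h
  obtain ⟨t, htA, hdisj, hcov⟩ := Vitali.exists_disjoint_subfamily_covering_enlargement_closedBall
    A id r K hrK 5 (by norm_num)
  have ht : t.Countable := hdisj.countable_of_nonempty_interior fun x hx =>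
    ⟨x, Metric.ball_subset_interior_closedBall (Metric.mem_ball_self (hr0 x (htA hx)))⟩
  have hsub : A ⊆ ⋃ x ∈ t, Metric.closedBall x (5 * r x) := fun x hx => by
    obtain ⟨y, hy, hxy⟩ := hcov x hx
    exact mem_biUnion hy (hxy (Metric.mem_closedBall_self (hr0 x hx).le))
  have := ht.to_subtype
  calc c * volume A ≤ c * ∑' x : t, volume (Metric.closedBall (x : Rd d) (5 * r x)) := by
        gcongr
        exact (measure_mono hsub).trans (measure_biUnion_le _ ht _)
    _ = 5 ^ d * ∑' x : t, c * volume (Metric.closedBall (x : Rd d) (r x)) := by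
        rw [← ENNReal.tsum_mul_left, ← ENNReal.tsum_mul_left]
        refine tsum_congr fun x => ?_
        rw [Measure.addHaar_closedBall_mul_of_pos _ _ (by norm_num), finrank_euclideanSpace_fin,
          ENNReal.ofReal_pow (by norm_num), ENNReal.ofReal_ofNat,
          Measure.addHaar_closedBall_center volume (x : Rd d)]
        ring
    _ ≤ 5 ^ d * ∑' x : t, ∫⁻ y in Metric.closedBall (x : Rd d) (r x), F y := by
        gcongr with x
        exact hr x (htA x.2)
    _ = 5 ^ d * ∫⁻ y in ⋃ x ∈ t, Metric.closedBall (x : Rd d) (r x), F y := by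
        rw [lintegral_biUnion ht (fun x _ => Metric.isClosed_closedBall.measurableSet)
          (show t.PairwiseDisjoint fun x => Metric.closedBall x (r x) from hdisj)]
    _ ≤ 5 ^ d * ∫⁻ y in Metric.closedBall (0 : Rd d) (R + K), F y := by
        gcongr
        refine iUnion₂_subset fun x hx => Metric.closedBall_subset_closedBall' ?_
        have h1 := Metric.mem_closedBall.1 (hA (htA hx))
        have h2 := hrK x (htA hx)
        linarith

section Flow

variable {d : ℕ} {Ω : Type*} [MeasurableSpace Ω] {P : Measure Ω} {τ : Rd d → Ω → Ω}

/-- Stationarity is assumed for images; the group law turns the preimage under `τ x` into the image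
under `τ (-x)`. -/
theorem IsStationaryErgodic.measurePreserving (hτ : IsStationaryErgodic P τ) (x : Rd d) :
    MeasurePreserving (τ x) P P := by
  have hm : Measurable (τ x) := hτ.measurable.comp measurable_prodMk_left
  refine ⟨hm, Measure.ext fun A hA => ?_⟩
  have hpre : τ x ⁻¹' A = τ (-x) '' A := by
    ext ω
    refine ⟨fun h => ⟨τ x ω, h, by rw [hτ.add, neg_add_cancel, hτ.zero]⟩, ?_⟩
    rintro ⟨ω', h, rfl⟩
    rw [mem_preimage, hτ.add, add_neg_cancel, hτ.zero]
    exact h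
  rw [Measure.map_apply hm hA, hpre, hτ.stationary _ A hA]

/-- The set where some average of `h` along the flow, over a ball of integer radius at most `K`,
exceeds `c`. -/
def maximalSet (τ : Rd d → Ω → Ω) (h : Ω → ℝ≥0∞) (c : ℝ≥0∞) (K : ℕ) : Set Ω :=
  ⋃ k ∈ Finset.Icc 1 K, {ω | c * volume (Metric.closedBall (0 : Rd d) k) <
    ∫⁻ y in Metric.closedBall (0 : Rd d) k, h (τ y ω)}

theorem measurableSet_maximalSet (hτ : IsStationaryErgodic P τ) {h : Ω → ℝ≥0∞}
    (hh : Measurable h) (c : ℝ≥0∞) (K : ℕ) : MeasurableSet (maximalSet τ h c K) := by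
  refine Finset.measurableSet_biUnion _ fun k _ => measurableSet_lt measurable_const ?_
  exact (hh.comp hτ.measurable).lintegral_prod_left'

/-- The maximal inequality for averages along the flow over balls of bounded radius. -/
theorem mul_measure_maximalSet_le [SFinite P] (hτ : IsStationaryErgodic P τ) {h : Ω → ℝ≥0∞}
    (hh : Measurable h) (c : ℝ≥0∞) (K : ℕ) :
    c * P (maximalSet τ h c K) ≤ 10 ^ d * ∫⁻ ω, h ω ∂P := by
  rcases Nat.eq_zero_or_pos K with rfl | hK
  · simp [maximalSet]
  set B : Set (Rd d) := Metric.closedBall 0 K with hB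
  have hBm : MeasurableSet B := Metric.isClosed_closedBall.measurableSet
  have hB0 : volume B ≠ 0 :=
    (Metric.measure_closedBall_pos volume 0 (by exact_mod_cast hK)).ne'
  have hBfin : volume B ≠ ∞ := measure_closedBall_lt_top.ne
  set E := maximalSet τ h c K with hE
  have hEm : MeasurableSet E := measurableSet_maximalSet hτ hh c K
  -- Transference: with `ω` fixed, `τ x ω ∈ E` says that `y ↦ h (τ y ω)` has a large average on a
  -- ball centred at `x` of radius at most `K`. Vitali applies on `ℝ^d`, and the balls stay within
  -- radius `2K`. Integrating in `ω` then gives the constant `5^d · 2^d`.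
  have hpt : ∀ ω, c * volume {x | x ∈ B ∧ τ x ω ∈ E} ≤
      5 ^ d * ∫⁻ y in Metric.closedBall (0 : Rd d) (K + K), h (τ y ω) := by
    intro ω
    refine mul_measure_le_of_forall_closedBall (fun x hx => hx.1) fun x hx => ?_
    obtain ⟨k, hk, hlt⟩ := mem_iUnion₂.1 hx.2
    rw [Finset.mem_Icc] at hk
    refine ⟨k, by exact_mod_cast hk.1, by exact_mod_cast hk.2, ?_⟩
    rw [Measure.addHaar_closedBall_center]
    refine (le_of_lt hlt).trans_eq ?_
    have htr := (measurePreserving_add_right volume x).setLIntegral_comp_preimage_emb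
      (measurableEmbedding_addRight x) (fun y => h (τ y ω)) (Metric.closedBall x k)
    have hball : (fun y => y + x) ⁻¹' Metric.closedBall x (k : ℝ) = Metric.closedBall 0 (k : ℝ) := by
      ext y
      simp [dist_eq_norm]
    rw [← htr, hball]
    simp only [hτ.add]
  have hfub : ∀ (g : Ω → ℝ≥0∞), Measurable g → ∀ A : Set (Rd d), MeasurableSet A →
      ∫⁻ ω, (∫⁻ y in A, g (τ y ω)) ∂P = volume A * ∫⁻ ω, g ω ∂P := by
    intro g hg A hA
    have hm : Measurable fun p : Ω × Rd d => g (τ p.2 p.1) :=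
      hg.comp (hτ.measurable.comp measurable_swap)
    rw [lintegral_lintegral_swap hm.aemeasurable]
    simp only [(hτ.measurePreserving _).lintegral_comp hg, lintegral_const,
      Measure.restrict_apply_univ, mul_comm]
  have hind : ∀ ω, volume {x | x ∈ B ∧ τ x ω ∈ E} = ∫⁻ x in B, E.indicator 1 (τ x ω) := by
    intro ω
    have hmω : MeasurableSet {x | τ x ω ∈ E} :=
      (hτ.measurable.comp measurable_prodMk_right) hEm
    have : (fun x => E.indicator (1 : Ω → ℝ≥0∞) (τ x ω)) = {x | τ x ω ∈ E}.indicator 1 := rfl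
    rw [this, lintegral_indicator_one hmω, Measure.restrict_apply hmω, inter_comm]
    rfl
  have hint := lintegral_mono (μ := P) hpt
  simp only [hind] at hint
  have hm1 : Measurable fun ω => ∫⁻ x in B, E.indicator (1 : Ω → ℝ≥0∞) (τ x ω) :=
    ((measurable_one.indicator hEm).comp hτ.measurable).lintegral_prod_left'
  have hm2 : Measurable fun ω => ∫⁻ y in Metric.closedBall (0 : Rd d) (K + K), h (τ y ω) :=
    (hh.comp hτ.measurable).lintegral_prod_left'
  rw [lintegral_const_mul _ hm1, lintegral_const_mul _ hm2,
    hfub _ (measurable_one.indicator hEm) _ hBm,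
    hfub _ hh _ Metric.isClosed_closedBall.measurableSet, lintegral_indicator_one hEm,
    ← two_mul, Measure.addHaar_closedBall_mul_of_pos _ _ (by norm_num), finrank_euclideanSpace_fin,
    ENNReal.ofReal_pow (by norm_num), ENNReal.ofReal_ofNat, ← hB] at hint
  refine (ENNReal.mul_le_mul_iff_right hB0 hBfin).1 ?_
  calc volume B * (c * P E) = c * (volume B * P E) := by ring
    _ ≤ _ := hint
    _ = volume B * (10 ^ d * ∫⁻ ω, h ω ∂P) := by
      rw [show (10 : ℝ≥0∞) = 5 * 2 by norm_num, mul_pow]; ring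

/-- The maximal inequality for averages along the flow over all balls of integer radius. -/
theorem mul_measure_iUnion_maximalSet_le [SFinite P] (hτ : IsStationaryErgodic P τ)
    {h : Ω → ℝ≥0∞} (hh : Measurable h) (c : ℝ≥0∞) :
    c * P (⋃ K, maximalSet τ h c K) ≤ 10 ^ d * ∫⁻ ω, h ω ∂P := by
  have hmono : Monotone (maximalSet τ h c) := fun K L hKL =>
    biUnion_subset_biUnion_left (Finset.coe_subset.2 (Finset.Icc_subset_Icc_right hKL))
  rw [hmono.measure_iUnion, ENNReal.mul_iSup]
  exact iSup_le fun K => mul_measure_maximalSet_le hτ hh c K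

/-- Almost surely, the points where a positive random field is small have a small proportion in
every ball of integer radius. -/
theorem ae_exists_forall_measure_closedBall_inter_le [IsFiniteMeasure P]
    (hτ : IsStationaryErgodic P τ) {Λ : Ω → ℝ} (hΛ : Measurable Λ) (hpos : ∀ᵐ ω ∂P, 0 < Λ ω)
    {c : ℝ≥0∞} (hc : c ≠ 0) :
    ∀ᵐ ω ∂P, ∃ N : ℕ, ∀ k : ℕ, 1 ≤ k →
      volume {y : Rd d | y ∈ Metric.closedBall 0 (k : ℝ) ∧ Λ (τ y ω) < 1 / ((N : ℝ) + 1)} ≤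
        c * volume (Metric.closedBall (0 : Rd d) k) := by
  let b : ℕ → Set Ω := fun N => {ω | Λ ω < 1 / ((N : ℝ) + 1)}
  have hb : ∀ N, MeasurableSet (b N) := fun N => measurableSet_lt hΛ measurable_const
  have hanti : Antitone b := fun M N hMN ω (hω : Λ ω < _) =>
    lt_of_lt_of_le hω (by gcongr)
  have hlim : Tendsto (fun N => P (b N)) atTop (𝓝 0) := by
    have hzero : P (⋂ N, b N) = 0 := by
      refine measure_mono_null (fun ω hω => ?_) (ae_iff.1 hpos)
      simp only [mem_ofPred_eq, not_lt]
      refine ge_of_tendsto' tendsto_one_div_add_atTop_nhds_zero_nat fun N => ?_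
      exact le_of_lt (mem_iInter.1 hω N)
    rw [← hzero]
    exact tendsto_measure_iInter_atTop (fun N => (hb N).nullMeasurableSet) hanti
      ⟨0, measure_ne_top _ _⟩
  -- The intersection lies in the exceptional set of every level `N`, so its probability is at most
  -- `10^d P(b N)/c` for all `N`.
  have hnull : P (⋂ N, ⋃ K, maximalSet τ ((b N).indicator 1) c K) = 0 := by
    have hle : ∀ N, c * P (⋂ N, ⋃ K, maximalSet τ ((b N).indicator 1) c K) ≤
        10 ^ d * P (b N) := fun N => by
      rw [← lintegral_indicator_one (hb N)]
      refine le_trans ?_ (mul_measure_iUnion_maximalSet_le hτ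
        (measurable_one.indicator (hb N)) c)
      gcongr
      exact iInter_subset _ N
    have h0 : Tendsto (fun N => (10 : ℝ≥0∞) ^ d * P (b N)) atTop (𝓝 0) := by
      simpa using ENNReal.Tendsto.const_mul hlim
        (Or.inr (ENNReal.pow_ne_top (by norm_num : (10 : ℝ≥0∞) ≠ ∞)))
    exact (mul_eq_zero.1 (le_antisymm (ge_of_tendsto' h0 hle) zero_le)).resolve_left hc
  filter_upwards [compl_mem_ae_iff.2 hnull] with ω hω
  simp only [mem_compl_iff, mem_iInter, not_forall] at hω
  obtain ⟨N, hN⟩ := hω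
  refine ⟨N, fun k hk => not_lt.1 fun hlt => hN ?_⟩
  refine mem_iUnion.2 ⟨k, mem_iUnion₂.2 ⟨k, Finset.mem_Icc.2 ⟨hk, le_rfl⟩, ?_⟩⟩
  have hmω : MeasurableSet {x : Rd d | τ x ω ∈ b N} :=
    (hτ.measurable.comp measurable_prodMk_right) (hb N)
  have : (fun x => (b N).indicator (1 : Ω → ℝ≥0∞) (τ x ω)) =
    {x | τ x ω ∈ b N}.indicator 1 := rfl
  rw [mem_ofPred_eq, this, lintegral_indicator_one hmω, Measure.restrict_apply hmω, inter_comm]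
  exact hlt

/-- Almost surely, the sets where the rescaled positive random field is small have small measure
in a given ball, uniformly in the scale. -/
theorem ae_forall_exists_forall_measure_scaled_le [IsFiniteMeasure P]
    (hτ : IsStationaryErgodic P τ) {Λ : Ω → ℝ} (hΛ : Measurable Λ)
    (hpos : ∀ᵐ ω ∂P, 0 < Λ ω) :
    ∀ᵐ ω ∂P, ∀ (m : ℕ) (η : ℝ≥0∞), 0 < η → ∃ N : ℕ, ∀ ε ∈ Ioc (0 : ℝ) 1,
      volume {x : Rd d | x ∈ Metric.ball 0 (m : ℝ) ∧
        Λ (τ (ε⁻¹ • x) ω) < 1 / ((N : ℝ) + 1)} ≤ η := by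
  -- Countably many proportions `1/j` suffice for an almost sure statement; `j = 0` means the
  -- proportion `∞` and is harmless.
  have hall : ∀ᵐ ω ∂P, ∀ j : ℕ, ∃ N : ℕ, ∀ k : ℕ, 1 ≤ k →
      volume {y : Rd d | y ∈ Metric.closedBall 0 (k : ℝ) ∧ Λ (τ y ω) < 1 / ((N : ℝ) + 1)} ≤
        (j : ℝ≥0∞)⁻¹ * volume (Metric.closedBall (0 : Rd d) k) :=
    ae_all_iff.2 fun j => ae_exists_forall_measure_closedBall_inter_le hτ hΛ hpos
      (ENNReal.inv_ne_zero.2 (ENNReal.natCast_ne_top j))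
  filter_upwards [hall] with ω hω m η hη
  have hfin : volume (Metric.closedBall (0 : Rd d) ((m : ℝ) + 1)) ≠ ∞ :=
    measure_closedBall_lt_top.ne
  obtain ⟨j, hj⟩ : ∃ j : ℕ,
      (j : ℝ≥0∞)⁻¹ * volume (Metric.closedBall (0 : Rd d) ((m : ℝ) + 1)) < η := by
    have h0 : Tendsto (fun j : ℕ =>
        (j : ℝ≥0∞)⁻¹ * volume (Metric.closedBall (0 : Rd d) ((m : ℝ) + 1))) atTop (𝓝 0) := by
      simpa using ENNReal.Tendsto.mul_const ENNReal.tendsto_inv_nat_nhds_zero (Or.inr hfin)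
    exact (h0.eventually (gt_mem_nhds hη)).exists
  obtain ⟨N, hN⟩ := hω j
  refine ⟨N, fun ε hε => ?_⟩
  have hε0 := hε.1
  -- An integer radius with `m/ε < k` and `εk ≤ m + ε ≤ m + 1`: the blown-up ball fits inside radius
  -- `k`, and scaling back stays within radius `m + 1`.
  set k : ℕ := ⌊(m : ℝ) / ε⌋₊ + 1 with hk
  have hmk : (m : ℝ) / ε < k := by rw [hk]; push_cast; exact Nat.lt_floor_add_one _
  have hkm : ε * k ≤ m + 1 := by
    have h1 : (⌊(m : ℝ) / ε⌋₊ : ℝ) ≤ m / ε := Nat.floor_le (by positivity)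
    rw [le_div_iff₀ hε0] at h1
    rw [hk]; push_cast
    linarith [hε.2]
  have hinv : ε⁻¹ ≠ 0 := inv_ne_zero hε0.ne'
  calc volume {x : Rd d | x ∈ Metric.ball 0 (m : ℝ) ∧ Λ (τ (ε⁻¹ • x) ω) < 1 / ((N : ℝ) + 1)}
      ≤ volume ((fun x : Rd d => ε⁻¹ • x) ⁻¹'
          {y | y ∈ Metric.closedBall 0 (k : ℝ) ∧ Λ (τ y ω) < 1 / ((N : ℝ) + 1)}) := by
        refine measure_mono fun x hx => ⟨?_, hx.2⟩
        have h1 := mem_ball_zero_iff.1 hx.1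
        rw [mem_closedBall_zero_iff, norm_smul, norm_inv, Real.norm_of_nonneg hε0.le,
          inv_mul_eq_div]
        exact (div_le_div_of_nonneg_right h1.le hε0.le).trans hmk.le
    _ ≤ (j : ℝ≥0∞)⁻¹ * volume ((fun x : Rd d => ε⁻¹ • x) ⁻¹' Metric.closedBall 0 (k : ℝ)) := by
        rw [Measure.addHaar_preimage_smul _ hinv, Measure.addHaar_preimage_smul _ hinv,
          mul_left_comm]
        gcongr
        exact hN k (Nat.le_add_left 1 _)
    _ ≤ (j : ℝ≥0∞)⁻¹ * volume (Metric.closedBall (0 : Rd d) ((m : ℝ) + 1)) := by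
        gcongr
        intro x hx
        rw [mem_preimage, mem_closedBall_zero_iff, norm_smul, norm_inv,
          Real.norm_of_nonneg hε0.le, inv_mul_le_iff₀ hε0] at hx
        exact mem_closedBall_zero_iff.2 (hx.trans hkm)
    _ ≤ η := hj.le

end Flow

/-! ### Translation estimate for a deterministic kernel -/

theorem lintegral_comp_sub_smul {d : ℕ} {δ : ℝ} (hδ : 0 < δ) {g : Rd d → ℝ≥0∞}
    (hg : Measurable g) (x : Rd d) :
    ∫⁻ w, g (x - δ • w) = ENNReal.ofReal ((δ ^ d)⁻¹) * ∫⁻ y, g y := by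
  have hm : Measurable fun z : Rd d => g (x - z) := hg.comp (by fun_prop)
  have h1 : ∫⁻ w, g (x - δ • w) = ∫⁻ z, g (x - z) ∂(Measure.map (fun w : Rd d => δ • w) volume) :=
    (lintegral_map hm (by fun_prop)).symm
  rw [h1, Measure.map_addHaar_smul volume hδ.ne', lintegral_smul_measure,
    lintegral_sub_left_eq_self, finrank_euclideanSpace_fin, abs_of_pos (by positivity), smul_eq_mul]

/-- The increment of a bounded function is controlled by its quadratic increment at pairs of points
where the kernel `k` is bounded from below. -/
theorem enorm_sub_le_indicator_add_energy {d : ℕ} {F : Rd d → ℝ} {C : ℝ} (hC : ∀ x, |F x| ≤ C)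
    {B : Set (Rd d)} {a b θ δ M : ℝ} (hM : 0 < M) (hθ : 0 < θ) (ha : 0 ≤ a)
    {x y : Rd d} (hxy : x ≠ y) (hd : ‖x - y‖ ≤ δ) (hb : x ∉ B → y ∉ B → M⁻¹ ≤ b) :
    ‖F x - F y‖ₑ ≤ ENNReal.ofReal (2 * C) * B.indicator 1 x +
      ENNReal.ofReal (2 * C) * B.indicator 1 y + ENNReal.ofReal θ +
      ENNReal.ofReal (θ⁻¹ * M * δ ^ a) *
        ENNReal.ofReal ((F x - F y) ^ 2 * (b / ‖x - y‖ ^ a)) := by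
  have hbd : ‖F x - F y‖ₑ ≤ ENNReal.ofReal (2 * C) := by
    rw [← ofReal_norm]
    refine ENNReal.ofReal_le_ofReal ((norm_sub_le _ _).trans ?_)
    have h1 := hC x
    have h2 := hC y
    rw [Real.norm_eq_abs, Real.norm_eq_abs]
    linarith
  by_cases hx : x ∈ B
  · rw [add_assoc, add_assoc]
    refine hbd.trans ?_
    simp [hx]
  by_cases hy : y ∈ B
  · rw [add_comm (ENNReal.ofReal (2 * C) * _), add_assoc, add_assoc]
    refine hbd.trans ?_
    simp [hy]
  have hr : 0 < ‖x - y‖ := norm_sub_pos_iff.2 hxy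
  have hb' := hb hx hy
  have hra : ‖x - y‖ ^ a ≤ δ ^ a := Real.rpow_le_rpow hr.le hd ha
  have hra0 : 0 < ‖x - y‖ ^ a := Real.rpow_pos_of_pos hr a
  have hb0 : 0 < b := (inv_pos.2 hM).trans_le hb'
  have hδa : 0 < δ ^ a := hra0.trans_le hra
  -- Off `B` the weight, once normalised, is at least `1`, so it can be inserted in front of the
  -- squared increment.
  have hone : 1 ≤ M * δ ^ a * (b / ‖x - y‖ ^ a) := by
    have h1 : 1 ≤ M * b := by
      rw [← mul_inv_cancel₀ hM.ne']
      gcongr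
    have h2 : 1 ≤ δ ^ a / ‖x - y‖ ^ a := (one_le_div hra0).2 hra
    calc (1 : ℝ) ≤ (M * b) * (δ ^ a / ‖x - y‖ ^ a) := one_le_mul_of_one_le_of_one_le h1 h2
      _ = _ := by ring
  have hyoung : |F x - F y| ≤ θ + θ⁻¹ * (F x - F y) ^ 2 := by
    have h3 : 0 < θ⁻¹ := inv_pos.2 hθ
    rcases le_total |F x - F y| θ with h | h
    · exact h.trans (le_add_of_nonneg_right (by positivity))
    · refine le_add_of_nonneg_of_le hθ.le ?_
      rw [← sq_abs, ← div_eq_inv_mul, le_div_iff₀ hθ, sq]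
      gcongr
  simp only [indicator_of_notMem hx, indicator_of_notMem hy, mul_zero, zero_add]
  rw [← ofReal_norm, ← ENNReal.ofReal_mul (by positivity),
    ← ENNReal.ofReal_add hθ.le (by positivity), Real.norm_eq_abs]
  refine ENNReal.ofReal_le_ofReal (hyoung.trans (add_le_add_right ?_ θ))
  calc θ⁻¹ * (F x - F y) ^ 2 ≤
      θ⁻¹ * (F x - F y) ^ 2 * (M * δ ^ a * (b / ‖x - y‖ ^ a)) :=
        le_mul_of_one_le_right (by positivity) hone
    _ = _ := by ring

/-- The pointwise bound is integrated term by term. `B` counts twice, once for `x` and once for `x -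
δw`; the substitution `y = x - δw` turns the last term into the energy at the price of `δ^{-d}`. For
`a = d + α` the net gain is `δ^α`. -/
theorem lintegral_translation_le {d : ℕ} {S : Set (Rd d)} (hS : MeasurableSet S)
    {Γ : Set (Rd d)} (hΓ : IsOpen Γ) {k : Rd d → Rd d → ℝ}
    (hk : Measurable fun p : Rd d × Rd d => k p.1 p.2) {F : Rd d → ℝ} (hF : Measurable F)
    {C : ℝ} (hC : ∀ x, |F x| ≤ C) {B : Set (Rd d)} (hB : MeasurableSet B) {A : Set (Rd d)}
    (hA : MeasurableSet A)
    {a θ δ M : ℝ} (hM : 0 < M) (hθ : 0 < θ) (ha : 0 ≤ a) (hδ : 0 < δ)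
    (hSΓ : ∀ w ∈ S, w ≠ 0 ∧ ‖w‖ ≤ 1 ∧ δ • w ∈ Γ)
    (hb : ∀ x ∈ A, ∀ w ∈ S, x ∉ B → x - δ • w ∉ B → M⁻¹ ≤ k x (x - δ • w)) :
    ∫⁻ x in A, ∫⁻ w in S, ‖F x - F (x - δ • w)‖ₑ ≤
      2 * (ENNReal.ofReal (2 * C) * (volume S * volume B)) +
      ENNReal.ofReal θ * (volume S * volume A) +
      ENNReal.ofReal (θ⁻¹ * M * δ ^ a * (δ ^ d)⁻¹) *
        ∫⁻ p in {p : Rd d × Rd d | p.1 ≠ p.2 ∧ p.1 - p.2 ∈ Γ},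
          ENNReal.ofReal ((F p.1 - F p.2) ^ 2 * (k p.1 p.2 / ‖p.1 - p.2‖ ^ a)) := by
  set D : Set (Rd d × Rd d) := {p | p.1 ≠ p.2 ∧ p.1 - p.2 ∈ Γ} with hD
  have hDm : MeasurableSet D := by
    refine MeasurableSet.inter (measurableSet_eq_fun measurable_fst measurable_snd).compl ?_
    exact (measurable_fst.sub measurable_snd) hΓ.measurableSet
  set J : Rd d × Rd d → ℝ≥0∞ := fun p =>
    ENNReal.ofReal ((F p.1 - F p.2) ^ 2 * (k p.1 p.2 / ‖p.1 - p.2‖ ^ a)) with hJ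
  have hJm : Measurable J := by
    refine ENNReal.measurable_ofReal.comp (Measurable.mul ?_ (hk.div ?_))
    · exact ((hF.comp measurable_fst).sub (hF.comp measurable_snd)).pow_const 2
    · exact (measurable_fst.sub measurable_snd).norm.pow_const a
  have hJD : Measurable (D.indicator J) := hJm.indicator hDm
  set c := ENNReal.ofReal (2 * C)
  set q := ENNReal.ofReal (θ⁻¹ * M * δ ^ a)
  have hshift : Measurable fun p : Rd d × Rd d => p.1 - δ • p.2 := by fun_prop
  have hBi : Measurable (B.indicator (1 : Rd d → ℝ≥0∞)) := measurable_one.indicator hB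
  have hpt : ∀ x ∈ A, ∀ w ∈ S, ‖F x - F (x - δ • w)‖ₑ ≤
      c * B.indicator 1 x + c * B.indicator 1 (x - δ • w) + ENNReal.ofReal θ +
        q * D.indicator J (x, x - δ • w) := by
    intro x hx w hw
    obtain ⟨hw0, hw1, hwΓ⟩ := hSΓ w hw
    have hne : δ • w ≠ 0 := smul_ne_zero hδ.ne' hw0
    have hmem : (x, x - δ • w) ∈ D := ⟨fun h => hne (by
      have := sub_eq_self.1 h.symm; exact this), by simpa using hwΓ⟩
    rw [indicator_of_mem hmem]
    refine enorm_sub_le_indicator_add_energy hC hM hθ ha hmem.1 ?_ (hb x hx w hw)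
    rw [sub_sub_cancel, norm_smul, Real.norm_of_nonneg hδ.le]
    exact mul_le_of_le_one_right hδ.le hw1
  have hI1 : ∫⁻ x in A, ∫⁻ _ in S, c * B.indicator 1 x ≤ c * (volume S * volume B) := by
    simp only [lintegral_const, Measure.restrict_apply_univ]
    rw [lintegral_mul_const _ (hBi.const_mul c), lintegral_const_mul _ hBi,
      lintegral_indicator_one hB, mul_assoc, mul_comm (volume S)]
    gcongr
    exact Measure.restrict_le_self
  have hI2 : ∫⁻ x in A, ∫⁻ w in S, c * B.indicator 1 (x - δ • w) ≤
      c * (volume S * volume B) := by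
    rw [lintegral_lintegral_swap ((hBi.comp hshift).const_mul c).aemeasurable]
    calc ∫⁻ w in S, ∫⁻ x in A, c * B.indicator 1 (x - δ • w)
        ≤ ∫⁻ _ in S, c * volume B := by
          refine lintegral_mono fun w => (setLIntegral_le_lintegral _ _).trans_eq ?_
          rw [lintegral_sub_right_eq_self (fun x => c * B.indicator (1 : Rd d → ℝ≥0∞) x),
            lintegral_const_mul _ hBi, lintegral_indicator_one hB]
      _ = _ := by
          rw [lintegral_const, Measure.restrict_apply_univ]; ring
  have hI3 : ∫⁻ _ in A, ∫⁻ _ in S, ENNReal.ofReal θ =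
      ENNReal.ofReal θ * (volume S * volume A) := by
    simp only [lintegral_const, Measure.restrict_apply_univ]; ring
  have hI4 : ∫⁻ x in A, ∫⁻ w in S, q * D.indicator J (x, x - δ • w) ≤
      ENNReal.ofReal (θ⁻¹ * M * δ ^ a * (δ ^ d)⁻¹) * ∫⁻ p in D, J p := by
    calc ∫⁻ x in A, ∫⁻ w in S, q * D.indicator J (x, x - δ • w)
        ≤ ∫⁻ x, ∫⁻ w, q * D.indicator J (x, x - δ • w) :=
          (lintegral_mono fun x => setLIntegral_le_lintegral _ _).trans
            (setLIntegral_le_lintegral _ _)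
      _ = ∫⁻ x, q * ENNReal.ofReal ((δ ^ d)⁻¹) * ∫⁻ y, D.indicator J (x, y) := by
          refine lintegral_congr fun x => ?_
          have hx : Measurable fun y => D.indicator J (x, y) := hJD.comp measurable_prodMk_left
          rw [lintegral_comp_sub_smul hδ (g := fun y => q * D.indicator J (x, y))
            (hx.const_mul q), lintegral_const_mul _ hx]
          ring
      _ = _ := by
          rw [lintegral_const_mul _ hJD.lintegral_prod_right', ← lintegral_indicator hDm,
            Measure.volume_eq_prod, lintegral_prod _ hJD.aemeasurable,
            ENNReal.ofReal_mul (by positivity)]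
  have hm2 : Measurable fun p : Rd d × Rd d => c * B.indicator (1 : Rd d → ℝ≥0∞) (p.1 - δ • p.2) :=
    (hBi.comp hshift).const_mul c
  have hm3 : Measurable fun p : Rd d × Rd d => q * D.indicator J (p.1, p.1 - δ • p.2) :=
    (hJD.comp (measurable_fst.prodMk hshift)).const_mul q
  calc ∫⁻ x in A, ∫⁻ w in S, ‖F x - F (x - δ • w)‖ₑ
      ≤ ∫⁻ x in A, ∫⁻ w in S, (c * B.indicator 1 x + c * B.indicator 1 (x - δ • w) +
          ENNReal.ofReal θ + q * D.indicator J (x, x - δ • w)) :=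
        setLIntegral_mono' hA fun x hx => setLIntegral_mono' hS (hpt x hx)
    _ = (∫⁻ x in A, ∫⁻ _ in S, c * B.indicator 1 x) +
        (∫⁻ x in A, ∫⁻ w in S, c * B.indicator 1 (x - δ • w)) +
        (∫⁻ _ in A, ∫⁻ _ in S, ENNReal.ofReal θ) +
        ∫⁻ x in A, ∫⁻ w in S, q * D.indicator J (x, x - δ • w) := by
      have e : ∀ x, ∫⁻ w in S, (c * B.indicator 1 x + c * B.indicator 1 (x - δ • w) +
          ENNReal.ofReal θ + q * D.indicator J (x, x - δ • w)) =
          (∫⁻ _ in S, c * B.indicator 1 x) + (∫⁻ w in S, c * B.indicator 1 (x - δ • w)) +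
          (∫⁻ _ in S, ENNReal.ofReal θ) + ∫⁻ w in S, q * D.indicator J (x, x - δ • w) := by
        intro x
        have h2 : Measurable fun w => c * B.indicator (1 : Rd d → ℝ≥0∞) (x - δ • w) :=
          hm2.comp measurable_prodMk_left
        have h3 : Measurable fun w => q * D.indicator J (x, x - δ • w) :=
          hm3.comp measurable_prodMk_left
        rw [lintegral_add_right _ h3,
          lintegral_add_right _ measurable_const, lintegral_add_right _ h2]
      simp only [e]
      rw [lintegral_add_right _ hm3.lintegral_prod_right',
          lintegral_add_right _ measurable_const, lintegral_add_right _ hm2.lintegral_prod_right']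
    _ ≤ _ := by
      rw [hI3, two_mul]
      gcongr

/-! ### Directions in the cone and bounded representatives -/

/-- Supplies the averaging set `S`; since `Γ` is a cone, `δS ⊆ Γ` for every `δ > 0`. The dimension
matters: for `d = 0` the set `{0}` is a cone. -/
theorem IsSymmetricCone.exists_ball {d : ℕ} (hd : 1 ≤ d) {Γ : Set (Rd d)}
    (hΓ : IsSymmetricCone Γ) :
    ∃ (x : Rd d) (r : ℝ), 0 < r ∧ ∀ w ∈ Metric.ball x r, w ≠ 0 ∧ ‖w‖ ≤ 1 ∧ w ∈ Γ := by
  have : Nonempty (Fin d) := ⟨⟨0, hd⟩⟩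
  have : Nontrivial (Rd d) := inferInstance
  have hU : IsOpen (Γ ∩ {0}ᶜ) := hΓ.isOpen.inter isOpen_compl_singleton
  obtain ⟨z, hzΓ, hz0⟩ : (Γ ∩ {0}ᶜ).Nonempty := by
    have hdense : Dense ({0}ᶜ : Set (Rd d)) := dense_compl_singleton 0
    exact hdense.inter_open_nonempty _ hΓ.isOpen hΓ.nonempty
  have hzn : 0 < ‖z‖ := norm_pos_iff.2 hz0
  -- Rescales `z` to norm `1/2`, inside the open unit ball.
  set s : ℝ := (2 * ‖z‖)⁻¹ with hs
  have hs0 : 0 < s := by positivity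
  have hV : IsOpen (Γ ∩ {0}ᶜ ∩ Metric.ball 0 1) := hU.inter Metric.isOpen_ball
  have hmem : s • z ∈ Γ ∩ {0}ᶜ ∩ Metric.ball 0 1 := by
    refine ⟨⟨hΓ.smul_mem z hzΓ s hs0.ne', smul_ne_zero hs0.ne' hz0⟩, ?_⟩
    rw [mem_ball_zero_iff, norm_smul, Real.norm_of_nonneg hs0.le, hs]
    field_simp
    norm_num
  obtain ⟨r, hr, hsub⟩ := Metric.isOpen_iff.1 hV _ hmem
  exact ⟨s • z, r, hr, fun w hw => ⟨(hsub hw).1.2, (mem_ball_zero_iff.1 (hsub hw).2).le,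
    (hsub hw).1.1⟩⟩

/-- Truncating a measurable version at `±C` gives the bound at every point, as the compactness
criterion requires. -/
theorem exists_measurable_bounded_ae_eq {X : Type*} [MeasurableSpace X] {ν : Measure X}
    {F : X → ℝ} (hF : AEStronglyMeasurable F ν) {C : ℝ} (hC0 : 0 ≤ C)
    (hC : eLpNorm F ∞ ν ≤ ENNReal.ofReal C) :
    ∃ u : X → ℝ, Measurable u ∧ (∀ x, |u x| ≤ C) ∧ u =ᵐ[ν] F := by
  refine ⟨fun x => max (-C) (min (hF.mk F x) C),
    measurable_const.max (hF.stronglyMeasurable_mk.measurable.min measurable_const), fun x => ?_, ?_⟩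
  · exact abs_le.2 ⟨le_max_left _ _, max_le (by linarith) (min_le_right _ _)⟩
  · rw [eLpNorm_exponent_top] at hC
    filter_upwards [hF.ae_eq_mk, enorm_ae_le_eLpNormEssSup F ν] with x hx hxC
    have h1 : |F x| ≤ C := by
      rw [← Real.norm_eq_abs, ← ENNReal.ofReal_le_ofReal_iff hC0, ofReal_norm]
      exact hxC.trans hC
    rw [abs_le] at h1
    rw [← hx, min_eq_left h1.2, max_eq_right h1.1]

theorem scaledEnergy_congr_ae {d : ℕ} {Ω : Type*} {κ : Rd d → Rd d → Ω → ℝ}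
    (Γ : Set (Rd d)) (α ε : ℝ) (ω : Ω) {f g : Rd d → ℝ}
    (h : f =ᵐ[volume] g) : scaledEnergy κ Γ α ε ω f = scaledEnergy κ Γ α ε ω g := by
  unfold scaledEnergy
  congr 1
  refine lintegral_congr_ae (ae_restrict_of_ae ?_)
  rw [Measure.volume_eq_prod]
  filter_upwards [Measure.quasiMeasurePreserving_fst.ae h,
    Measure.quasiMeasurePreserving_snd.ae h] with p h1 h2
  rw [h1, h2]

/-! ### Translation estimate for the random coefficient -/

section Flow

variable {d : ℕ} {Ω : Type*} [MeasurableSpace Ω] {P : Measure Ω} {τ : Rd d → Ω → Ω}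
  {κ : Rd d → Rd d → Ω → ℝ}

/-- Functions in the domain are measurable only up to `μ^{ε,ω}`-null sets; this transfers their
measurability to Lebesgue measure. Dilations preserve null sets, so the density is positive almost
everywhere. -/
theorem volume_absolutelyContinuous_scaledMeasure {μ : Ω → ℝ} (hτ : IsStationaryErgodic P τ)
    (hμ : IsReferenceDensity P τ μ) {ε : ℝ} (hε : 0 < ε) (ω : Ω) :
    (volume : Measure (Rd d)) ≪ scaledMeasure τ μ ε ω := by
  have hsm : Measurable fun x : Rd d => ε⁻¹ • x := measurable_const_smul _
  refine withDensity_absolutelyContinuous' ?_ ?_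
  · exact (ENNReal.measurable_ofReal.comp (hμ.measurable.comp
      ((hτ.measurable.comp measurable_prodMk_right).comp hsm))).aemeasurable
  · have hq : Measure.QuasiMeasurePreserving (fun x : Rd d => ε⁻¹ • x) volume volume := by
      refine ⟨hsm, ?_⟩
      rw [Measure.map_addHaar_smul volume (inv_ne_zero hε.ne')]
      exact Measure.smul_absolutelyContinuous
    filter_upwards [hq.ae (hμ.pos ω)] with x hx
    exact (ENNReal.ofReal_pos.2 hx).ne'

theorem ae_pos_of_lintegral_inv_lt_top {Λ : Ω → ℝ} (hΛ : Measurable Λ)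
    (h : ∫⁻ ω, (ENNReal.ofReal (Λ ω))⁻¹ ∂P < ∞) : ∀ᵐ ω ∂P, 0 < Λ ω := by
  filter_upwards [ae_lt_top (ENNReal.measurable_ofReal.comp hΛ).inv h.ne] with ω hω
  exact ENNReal.ofReal_pos.1 (ENNReal.inv_lt_top.1 hω)

/-- Both types of bounds give a positive random field such that `κ` is bounded from below at the
pairs of points where the field is. -/
theorem exists_lower_bound (hAB : SumBounds P τ κ ∨ ProductBounds P τ κ) :
    ∃ Λ : Ω → ℝ, Measurable Λ ∧ (∀ᵐ ω ∂P, 0 < Λ ω) ∧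
      ∀ᵐ ω ∂P, ∀ x y, ∀ s ∈ Ioc (0 : ℝ) 1, s ≤ Λ (τ x ω) → s ≤ Λ (τ y ω) → s ^ 2 ≤ κ x y ω := by
  rcases hAB with ⟨Λ, Λ', hm, -, -, hb, hint⟩ | ⟨Λ, Λ', hm, -, -, hb, hint⟩
  · refine ⟨Λ, hm, ae_pos_of_lintegral_inv_lt_top hm hint, ?_⟩
    filter_upwards [hb] with ω hω x y s hs hx hy
    have h1 := (hω x y).1
    -- Since `s ≤ 1`, `s² ≤ s ≤ 2s`.
    nlinarith [hs.1, hs.2]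
  · refine ⟨Λ, hm, ae_pos_of_lintegral_inv_lt_top hm hint, ?_⟩
    filter_upwards [hb] with ω hω x y s hs hx hy
    rw [sq]
    exact (mul_le_mul hx hy hs.1.le (hs.1.le.trans hx)).trans (hω x y).1

/-- Uniformly over the bounded functions of bounded scaled energy, the translates of a function
in the directions of a bounded part of the cone are close to it in `L¹` of a ball, provided the
random field bounding `κ` from below is small only on sets of small measure. -/
theorem exists_translation_estimate (hm : Measurable fun p : Rd d × Rd d × Ω => κ p.1 p.2.1 p.2.2)
    (hτ : IsStationaryErgodic P τ) {Λ : Ω → ℝ} (hΛ : Measurable Λ) {ω : Ω}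
    (hlow : ∀ x y, ∀ s ∈ Ioc (0 : ℝ) 1, s ≤ Λ (τ x ω) → s ≤ Λ (τ y ω) → s ^ 2 ≤ κ x y ω)
    (htight : ∀ (m : ℕ) (η : ℝ≥0∞), 0 < η → ∃ N : ℕ, ∀ ε ∈ Ioc (0 : ℝ) 1,
      volume {x : Rd d | x ∈ Metric.ball 0 (m : ℝ) ∧
        Λ (τ (ε⁻¹ • x) ω) < 1 / ((N : ℝ) + 1)} ≤ η)
    {Γ : Set (Rd d)} (hΓ : IsSymmetricCone Γ) {S : Set (Rd d)} (hS : MeasurableSet S)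
    (hSΓ : ∀ w ∈ S, w ≠ 0 ∧ ‖w‖ ≤ 1 ∧ w ∈ Γ) {α : ℝ} (hα : 0 < α) (C : ℝ) {b : ℝ≥0∞}
    (hb : b ≠ ∞) (m : ℕ) {η : ℝ≥0∞} (hη : 0 < η) :
    ∃ δ : ℝ, 0 < δ ∧ ∀ ε ∈ Ioc (0 : ℝ) 1, ∀ F : Rd d → ℝ, Measurable F → (∀ x, |F x| ≤ C) →
      scaledEnergy κ Γ α ε ω F ≤ b →
      ∫⁻ x in Metric.ball (0 : Rd d) m, ∫⁻ w in S, ‖F x - F (x - δ • w)‖ₑ ≤ η := by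
  have hη3 : η / 3 ≠ 0 := (ENNReal.div_pos hη.ne' (by norm_num)).ne'
  have hSfin : volume S ≠ ∞ := by
    refine ((measure_mono fun w hw => mem_closedBall_zero_iff.2 (hSΓ w hw).2.1).trans_lt
      (measure_closedBall_lt_top (x := (0 : Rd d)) (r := 1))).ne
  have hAfin : volume (Metric.ball (0 : Rd d) m) ≠ ∞ := measure_ball_lt_top.ne
  obtain ⟨η₁, hη₁, hη₁'⟩ := ENNReal.exists_nnreal_pos_mul_lt
    (a := 2 * (ENNReal.ofReal (2 * C) * volume S)) (by finiteness) hη3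
  -- Radius `m + 1`, because `x - δw` leaves the ball of radius `m` by at most `δ ≤ 1`.
  obtain ⟨N, hN⟩ := htight (m + 1) η₁ (by exact_mod_cast hη₁)
  obtain ⟨θ, hθ, hθ'⟩ := ENNReal.exists_nnreal_pos_mul_lt
    (a := volume S * volume (Metric.ball (0 : Rd d) m)) (by finiteness) hη3
  obtain ⟨ρ, hρ, hρ'⟩ := ENNReal.exists_nnreal_pos_mul_lt (a := 2 * b) (by finiteness) hη3
  set s : ℝ := 1 / ((N : ℝ) + 1) with hs
  have hs0 : 0 < s := by positivity
  have hs1 : s ≤ 1 := by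
    rw [hs, div_le_one (by positivity)]
    have : (0 : ℝ) ≤ N := N.cast_nonneg
    linarith
  -- Solves `θ⁻¹ s⁻² δ^α = ρ`, the admissible coefficient of the energy.
  set δ₀ : ℝ := (ρ * θ * s ^ 2 : ℝ) ^ α⁻¹ with hδ₀
  have hδ₀pos : 0 < δ₀ := by positivity
  set δ : ℝ := min 1 δ₀ with hδ
  have hδpos : 0 < δ := lt_min one_pos hδ₀pos
  refine ⟨δ, hδpos, fun ε hε F hF hFC hE => ?_⟩
  set B : Set (Rd d) := {x | x ∈ Metric.ball 0 ((m + 1 : ℕ) : ℝ) ∧ Λ (τ (ε⁻¹ • x) ω) < s} with hB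
  have hsm : Measurable fun x : Rd d => ε⁻¹ • x := measurable_const_smul _
  have hBm : MeasurableSet B := Metric.isOpen_ball.measurableSet.inter
    (measurableSet_lt (hΛ.comp ((hτ.measurable.comp measurable_prodMk_right).comp hsm))
      measurable_const)
  have hkm : Measurable fun p : Rd d × Rd d => κ (ε⁻¹ • p.1) (ε⁻¹ • p.2) ω :=
    hm.comp ((hsm.comp measurable_fst).prodMk ((hsm.comp measurable_snd).prodMk measurable_const))
  have hdα : 0 ≤ (d : ℝ) + α := by positivity
  have key := lintegral_translation_le hS hΓ.isOpen (k := fun x y => κ (ε⁻¹ • x) (ε⁻¹ • y) ω) hkm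
    hF hFC hBm (A := Metric.ball (0 : Rd d) m) Metric.isOpen_ball.measurableSet
    (M := (s ^ 2)⁻¹) (θ := θ) (by positivity) (by exact_mod_cast hθ) hdα hδpos
    (fun w hw => ⟨(hSΓ w hw).1, (hSΓ w hw).2.1, hΓ.smul_mem w (hSΓ w hw).2.2 δ hδpos.ne'⟩)
    (by
      intro x hx w hw hxB hyB
      rw [mem_ball_zero_iff] at hx
      have hyn : ‖x - δ • w‖ < m + 1 := by
        refine (norm_sub_le _ _).trans_lt (add_lt_add_of_lt_of_le hx ?_)
        rw [norm_smul, Real.norm_of_nonneg hδpos.le]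
        exact mul_le_one₀ (min_le_left _ _) (norm_nonneg _) (hSΓ w hw).2.1
      rw [inv_inv]
      refine hlow _ _ s ⟨hs0, hs1⟩ (not_lt.1 fun h => hxB ⟨?_, h⟩) (not_lt.1 fun h => hyB ⟨?_, h⟩)
      · rw [mem_ball_zero_iff]; push_cast; linarith
      · rw [mem_ball_zero_iff]; push_cast; exact hyn)
  refine key.trans ?_
  have hcoef : (θ : ℝ)⁻¹ * (s ^ 2)⁻¹ * δ ^ ((d : ℝ) + α) * (δ ^ d)⁻¹ ≤ ρ := by
    have h1 : δ ^ α ≤ ρ * θ * s ^ 2 := by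
      calc δ ^ α ≤ δ₀ ^ α := Real.rpow_le_rpow hδpos.le (min_le_right _ _) hα.le
        _ = ρ * θ * s ^ 2 := by
          rw [hδ₀, ← Real.rpow_mul (by positivity), inv_mul_cancel₀ hα.ne', Real.rpow_one]
    have hθr : (0 : ℝ) < θ := by exact_mod_cast hθ
    have hdd : (0 : ℝ) < δ ^ d := by positivity
    rw [Real.rpow_add hδpos, Real.rpow_natCast]
    calc (θ : ℝ)⁻¹ * (s ^ 2)⁻¹ * (δ ^ d * δ ^ α) * (δ ^ d)⁻¹
        = (θ : ℝ)⁻¹ * (s ^ 2)⁻¹ * δ ^ α := by field_simp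
      _ ≤ (θ : ℝ)⁻¹ * (s ^ 2)⁻¹ * (ρ * θ * s ^ 2) := by gcongr
      _ = ρ := by field_simp
  have hEn : ∫⁻ p in {p : Rd d × Rd d | p.1 ≠ p.2 ∧ p.1 - p.2 ∈ Γ},
      ENNReal.ofReal ((F p.1 - F p.2) ^ 2 *
        (κ (ε⁻¹ • p.1) (ε⁻¹ • p.2) ω / ‖p.1 - p.2‖ ^ ((d : ℝ) + α))) ≤ 2 * b := by
    unfold scaledEnergy at hE
    rwa [← ENNReal.div_eq_inv_mul, ENNReal.div_le_iff' (by norm_num) (by norm_num)] at hE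
  calc _ ≤ η / 3 + η / 3 + η / 3 := by
        refine add_le_add (add_le_add ?_ ?_) ?_
        · refine le_trans ?_ hη₁'.le
          calc 2 * (ENNReal.ofReal (2 * C) * (volume S * volume B))
              ≤ 2 * (ENNReal.ofReal (2 * C) * (volume S * η₁)) := by
                gcongr
                exact hN ε hε
            _ = _ := by ring
        · rw [ENNReal.ofReal_coe_nnreal]; exact hθ'.le
        · refine le_trans (mul_le_mul' ?_ hEn) hρ'.le
          rw [← ENNReal.ofReal_coe_nnreal]
          exact ENNReal.ofReal_le_ofReal hcoef
    _ = η := ENNReal.add_thirds η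

end Flow

/-! ### Conclusion -/

theorem proposition3p4 {d : ℕ} (hd : 1 ≤ d)
    {Ω : Type*} [MeasurableSpace Ω] (P : Measure Ω) [IsProbabilityMeasure P]
    (τ : Rd d → Ω → Ω) (hτ : IsStationaryErgodic P τ)
    (α : ℝ) (hα : α ∈ Ioo (0 : ℝ) 2)
    (μ : Ω → ℝ) (hμ : IsReferenceDensity P τ μ)
    (κ : Rd d → Rd d → Ω → ℝ) (hκ : IsRandomCoefficient P τ α κ)
    (Γ : Set (Rd d)) (hΓ : IsSymmetricCone Γ)
    (hAB : SumBounds P τ κ ∨ ProductBounds P τ κ) :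
    ∃ Ω₀ : Set Ω, MeasurableSet Ω₀ ∧ P Ω₀ = 1 ∧
      ∀ ω ∈ Ω₀, ∀ f : ℝ → Rd d → ℝ,
        (∀ ε ∈ Ioc (0 : ℝ) 1, f ε ∈ scaledDomain τ μ κ Γ α ε ω) →
        limsup (fun ε => eLpNorm (f ε) ∞ volume + scaledEnergy κ Γ α ε ω (f ε))
          (𝓝[>] (0 : ℝ)) < ∞ →
        PrecompactAtZero f := by
  obtain ⟨Λ, hΛ, hpos, hlow⟩ := exists_lower_bound hAB
  obtain ⟨Ω₀, hΩ₀, hΩ₀m, hgood⟩ :=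
    (hlow.and (ae_forall_exists_forall_measure_scaled_le hτ hΛ hpos)).exists_measurable_mem
  refine ⟨Ω₀, hΩ₀m, (mem_ae_iff_prob_eq_one hΩ₀m).1 hΩ₀, fun ω hω f hf hlim e he he0 => ?_⟩
  obtain ⟨hlowω, htight⟩ := hgood ω hω
  obtain ⟨x₀, r₀, hr₀, hball⟩ := hΓ.exists_ball hd
  obtain ⟨b, hlb, hb⟩ := exists_between hlim
  have hb' : b ≠ ∞ := hb.ne
  have he0' : Tendsto e atTop (𝓝[>] 0) :=
    tendsto_nhdsWithin_iff.2 ⟨he0, Eventually.of_forall fun n => (he n).1⟩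
  -- From `n₀` on, `b` bounds both the sup norm and the energy; the sequence is therefore shifted by
  -- `n₀`, and the estimates below hold for all its terms.
  obtain ⟨n₀, hn₀⟩ := eventually_atTop.1 (he0'.eventually (eventually_lt_of_limsup_lt hlb))
  have hex : ∀ n, ∃ u : Rd d → ℝ, Measurable u ∧ (∀ x, |u x| ≤ b.toReal) ∧
      u =ᵐ[volume] f (e (n + n₀)) := fun n => by
    refine exists_measurable_bounded_ae_eq ?_ ENNReal.toReal_nonneg ?_
    · exact (hf _ (he _)).1.1.mono_ac
        (volume_absolutelyContinuous_scaledMeasure hτ hμ (he _).1 ω)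
    · rw [ENNReal.ofReal_toReal hb']
      exact le_self_add.trans (hn₀ _ (Nat.le_add_left _ _)).le
  choose u hum hub huf using hex
  have hSm : MeasurableSet (Metric.ball x₀ r₀) := Metric.isOpen_ball.measurableSet
  obtain ⟨ψ, G, hψ, hG, hlimG⟩ := exists_subseq_tendsto_of_translation_estimate hSm
    measure_ball_lt_top.ne (Metric.measure_ball_pos volume x₀ hr₀).ne' hum hub
    (fun m η hη => by
      obtain ⟨δ, hδ, hest⟩ := exists_translation_estimate hκ.measurable hτ hΛ hlowω htight hΓ hSm
        hball hα.1 b.toReal hb' m hη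
      refine ⟨δ, hδ, 0, fun n _ => hest _ (he (n + n₀)) _ (hum n) (hub n) ?_⟩
      rw [scaledEnergy_congr_ae Γ α _ ω (huf n)]
      exact le_add_self.trans (hn₀ _ (Nat.le_add_left _ _)).le)
  refine ⟨fun k => ψ k + n₀, G, fun i j hij => Nat.add_lt_add_right (hψ hij) n₀, hG,
    fun r _ => (hlimG r).congr fun k => eLpNorm_congr_ae (ae_restrict_of_ae ?_)⟩
  filter_upwards [huf (ψ k)] with x hx
  simp [hx]
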